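/- Let $N\ge 3$ be an integer. For $\beta\in\mathbb{R}$ let $u_\beta=u_\beta(r)$, $r=|x|$, denote the (unique) classical radial solution of $$\Delta^2 u_\beta=e^{u_\beta},\qquad u_\beta(0)=0,\quad \Delta u_\beta(0)=\beta,\quad u_\beta'(0)=(\Delta u_\beta)'(0)=0,$$ in $\mathbb{R}^N$, on its maximal interval of existence $[0,R(\beta))$, where $\Delta f(r)=f''(r)+\frac{N-1}{r}f'(r)$ for $r>0$ and $\Delta f(0)=Nf''(0)$. Let $\beta_0$ be the supremum of all $\beta$ with $R(\beta)=\infty$. Then $\beta_0$ is a real number, $R(\beta)=\infty$ if and only if $\beta\le\beta_0$, and for every $\beta\le\beta_0$ the limit $\lim_{r\to\infty}\Delta u_\beta(r)$ exists, is finite and satisfies $$\lim_{r\to\infty}\Delta u_\beta(r)\le 0;$$ moreover, this limit equals $0$ if and only if $\beta=\beta_0$. -/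

import Mathlib

open Filter Topology

/-- The Laplacian in `ℝ^N` of the radial function `x ↦ f (‖x‖)`, read on its profile `f`:
`f'' + ((N - 1) / r) f' = r ^ (1 - N) (r ^ (N - 1) f')'` away from the origin, and `N f''(0)` at the
origin. -/
noncomputable def radialLaplacian (N : ℕ) (f : ℝ → ℝ) (r : ℝ) : ℝ :=
  if r = 0 then N * deriv (deriv f) 0
  else deriv (deriv f) r + ((N : ℝ) - 1) / r * deriv f r

/-- `u` is the profile of an entire classical radial solution of `Δ² u = e ^ u` in `ℝ^N` with
`u(0) = 0`, `Δu(0) = β` and `u'(0) = (Δu)'(0) = 0`.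

The profile is the restriction of the radial function to a line through the origin, so it is an
even function on `ℝ`; the radial function is `C⁴` on `ℝ^N` exactly when this even function is `C⁴`
on `ℝ`. -/
structure IsEntireRadialSolution (N : ℕ) (β : ℝ) (u : ℝ → ℝ) : Prop where
  even : ∀ r, u (-r) = u r
  contDiff : ContDiff ℝ 4 u
  equation : ∀ r, 0 ≤ r → radialLaplacian N (radialLaplacian N u) r = Real.exp (u r)
  value_zero : u 0 = 0
  laplacian_zero : radialLaplacian N u 0 = β
  deriv_zero : deriv u 0 = 0
  deriv_laplacian_zero : deriv (radialLaplacian N u) 0 = 0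

/-- The threshold `β₀` (in dimension `N`): the supremum of the `β` for which the radial solution
`u_β` exists on all of `[0, ∞)`. -/
noncomputable def betaZero (N : ℕ) : ℝ :=
  sSup {β : ℝ | ∃ u : ℝ → ℝ, IsEntireRadialSolution N β u}

/-! On radial functions the Laplacian is inverted by `radialPotential`, the operator `T f (r) = ∫₀^r
s^(1-N) ∫₀^s t^(N-1) f(t) dt ds`, written with integrals over `[0, 1]` so that the origin is not
singular. The problem becomes `u = T v` with `v = β + T (exp u)`, which is monotone in `u` and in
`β`.

The Laplacian `v` is nondecreasing on `[0, ∞)`. If it were positive somewhere, `u` would eventually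
grow and the exponential feedback would make it blow up at a finite radius (`false_of_nonneg`).
Hence `v ≤ 0`, its limit `σ` is at most `0`, and `β = v 0 ≤ 0`.

A supersolution yields a solution by decreasing iteration, so the admissible `β` form a down-set;
increasing limits show that the supremum `β₀` is attained.

If `β < β₀`, comparison keeps `v` at least `β₀ - β` below the Laplacian of the solution at `β₀`, so
`σ ≤ β - β₀ < 0` (`laplacian_sub_ge`). Conversely, if `σ < 0`, then `exp u` has Gaussian decay, and
for `N ≥ 3` its perturbations have bounded potentials; this leaves room to increase `β`
(`exists_gt`), so `β ≠ β₀`. -/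

/-! ### Weighted means and the radial potential: order, bounds, limits. -/

/-- The weighted mean `∫₀¹ t ^ k f (r t) dt` of `f` over the segment from `0` to `r`. -/
noncomputable def radialMean (k : ℕ) (f : ℝ → ℝ) (r : ℝ) : ℝ :=
  ∫ t in (0 : ℝ)..1, t ^ k * f (r * t)

/-- The radial solution `w` of `Δ w = f` in `ℝ^N` with `w 0 = 0`. -/
noncomputable def radialPotential (N : ℕ) (f : ℝ → ℝ) (r : ℝ) : ℝ :=
  r ^ 2 * radialMean 1 (radialMean (N - 1) f) r

theorem radialMean_intervalIntegrable {k : ℕ} {f : ℝ → ℝ} (hf : Continuous f) (r a b : ℝ) :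
    IntervalIntegrable (fun t => t ^ k * f (r * t)) MeasureTheory.volume a b :=
  Continuous.intervalIntegrable (by fun_prop) _ _

theorem radialMean_even {k : ℕ} {f : ℝ → ℝ} (hf : ∀ r, f (-r) = f r) (r : ℝ) :
    radialMean k f (-r) = radialMean k f r := by
  simp [radialMean, hf]

theorem radialPotential_even {N : ℕ} {f : ℝ → ℝ} (hf : ∀ r, f (-r) = f r) (r : ℝ) :
    radialPotential N f (-r) = radialPotential N f r := by
  simp [radialPotential, radialMean_even (radialMean_even hf)]

theorem radialMean_const (k : ℕ) (c r : ℝ) : radialMean k (fun _ => c) r = c / (k + 1) := by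
  simp [radialMean]
  ring

theorem radialMean_zero (k : ℕ) (f : ℝ → ℝ) : radialMean k f 0 = f 0 / (k + 1) := by
  simp [radialMean]
  ring

theorem radialPotential_zero (N : ℕ) (f : ℝ → ℝ) : radialPotential N f 0 = 0 := by
  simp [radialPotential]

theorem radialPotential_const {N : ℕ} (hN : 1 ≤ N) (c r : ℝ) :
    radialPotential N (fun _ => c) r = c * r ^ 2 / (2 * N) := by
  have h : radialMean (N - 1) (fun _ => c) = fun _ => c / N := by
    funext s
    rw [radialMean_const, Nat.cast_sub hN]
    simp
  rw [radialPotential, h, radialMean_const]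
  have : (N : ℝ) ≠ 0 := by positivity
  field_simp
  norm_num

theorem radialMean_add {k : ℕ} {f g : ℝ → ℝ} (hf : Continuous f) (hg : Continuous g) (r : ℝ) :
    radialMean k (fun s => f s + g s) r = radialMean k f r + radialMean k g r := by
  simp only [radialMean, mul_add]
  exact intervalIntegral.integral_add (radialMean_intervalIntegrable hf _ _ _)
    (radialMean_intervalIntegrable hg _ _ _)

theorem radialMean_mul_const (k : ℕ) (f : ℝ → ℝ) (c r : ℝ) :
    radialMean k (fun s => f s * c) r = radialMean k f r * c := by
  simp only [radialMean, ← mul_assoc]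
  exact intervalIntegral.integral_mul_const _ _

theorem continuous_radialMean {k : ℕ} {f : ℝ → ℝ} (hf : Continuous f) :
    Continuous (radialMean k f) := by
  unfold radialMean
  exact intervalIntegral.continuous_parametric_intervalIntegral_of_continuous' (by fun_prop) _ _

theorem continuous_radialPotential {N : ℕ} {f : ℝ → ℝ} (hf : Continuous f) :
    Continuous (radialPotential N f) := by
  have := continuous_radialMean (k := 1) (continuous_radialMean (k := N - 1) hf)
  unfold radialPotential
  fun_prop

theorem radialPotential_add {N : ℕ} {f g : ℝ → ℝ} (hf : Continuous f) (hg : Continuous g)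
    (r : ℝ) :
    radialPotential N (fun s => f s + g s) r = radialPotential N f r + radialPotential N g r := by
  have h : radialMean (N - 1) (fun s => f s + g s) =
      fun s => radialMean (N - 1) f s + radialMean (N - 1) g s := funext (radialMean_add hf hg)
  rw [radialPotential, h, radialMean_add (continuous_radialMean hf) (continuous_radialMean hg)]
  simp only [radialPotential]
  ring

theorem radialMean_mono {k : ℕ} {f g : ℝ → ℝ} (hf : Continuous f) (hg : Continuous g) {r : ℝ}
    (h : ∀ t ∈ Set.Icc (0 : ℝ) 1, f (r * t) ≤ g (r * t)) : radialMean k f r ≤ radialMean k g r := by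
  refine intervalIntegral.integral_mono_on zero_le_one (radialMean_intervalIntegrable hf _ _ _)
    (radialMean_intervalIntegrable hg _ _ _) fun t ht => ?_
  exact mul_le_mul_of_nonneg_left (h t ht) (pow_nonneg ht.1 _)

theorem radialPotential_mono {N : ℕ} {f g : ℝ → ℝ} (hf : Continuous f) (hg : Continuous g) {r : ℝ}
    (h : ∀ t ∈ Set.Icc (0 : ℝ) 1, f (r * t) ≤ g (r * t)) :
    radialPotential N f r ≤ radialPotential N g r := by
  refine mul_le_mul_of_nonneg_left ?_ (sq_nonneg r)
  refine radialMean_mono (continuous_radialMean hf) (continuous_radialMean hg) fun t ht =>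
    radialMean_mono hf hg fun s hs => ?_
  rw [mul_assoc]
  exact h _ ⟨mul_nonneg ht.1 hs.1, mul_le_one₀ ht.2 hs.1 hs.2⟩

theorem radialMean_nonneg {k : ℕ} {f : ℝ → ℝ} (hf : Continuous f) {r : ℝ}
    (h : ∀ t ∈ Set.Icc (0 : ℝ) 1, 0 ≤ f (r * t)) : 0 ≤ radialMean k f r := by
  simpa [radialMean_const] using radialMean_mono (k := k) (continuous_const (y := (0 : ℝ))) hf h

theorem radialPotential_nonneg {N : ℕ} {f : ℝ → ℝ} (hf : Continuous f) {r : ℝ}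
    (h : ∀ t ∈ Set.Icc (0 : ℝ) 1, 0 ≤ f (r * t)) : 0 ≤ radialPotential N f r :=
  mul_nonneg (sq_nonneg r) <| radialMean_nonneg (continuous_radialMean hf) fun t ht =>
    radialMean_nonneg hf fun s hs => by
      rw [mul_assoc]
      exact h _ ⟨mul_nonneg ht.1 hs.1, mul_le_one₀ ht.2 hs.1 hs.2⟩

theorem abs_radialMean_le {k : ℕ} {f : ℝ → ℝ} (hf : Continuous f) {R C : ℝ}
    (h : ∀ s, |s| ≤ R → |f s| ≤ C) {r : ℝ} (hr : |r| ≤ R) : |radialMean k f r| ≤ C := by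
  have hC : 0 ≤ C := (abs_nonneg _).trans (h r hr)
  have h1 : ∀ t ∈ Set.Icc (0 : ℝ) 1, |f (r * t)| ≤ C := fun t ht => h _ <| by
    rw [abs_mul, abs_of_nonneg ht.1]
    exact (mul_le_of_le_one_right (abs_nonneg _) ht.2).trans hr
  have hk : C / (k + 1) ≤ C := div_le_self hC (by simp)
  have h2 := radialMean_mono (k := k) hf (continuous_const (y := C)) fun t ht =>
    (abs_le.1 (h1 t ht)).2
  have h3 := radialMean_mono (k := k) (continuous_const (y := -C)) hf fun t ht =>
    (abs_le.1 (h1 t ht)).1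
  rw [radialMean_const] at h2 h3
  rw [neg_div] at h3
  exact abs_le.2 ⟨by linarith, by linarith⟩

theorem abs_radialPotential_le {N : ℕ} {f : ℝ → ℝ} (hf : Continuous f) {R C : ℝ}
    (h : ∀ s, |s| ≤ R → |f s| ≤ C) {r : ℝ} (hr : |r| ≤ R) :
    |radialPotential N f r| ≤ R ^ 2 * C := by
  have h1 := abs_radialMean_le (k := 1) (continuous_radialMean hf)
    (fun s hs => abs_radialMean_le (k := N - 1) hf h hs) hr
  rw [radialPotential, abs_mul, abs_of_nonneg (sq_nonneg r)]
  exact mul_le_mul (sq_le_sq' (by linarith [(abs_le.1 hr).1]) (abs_le.1 hr).2) h1 (abs_nonneg _)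
    (sq_nonneg R)

theorem tendsto_radialMean {k : ℕ} {f : ℕ → ℝ → ℝ} {g : ℝ → ℝ} (hf : ∀ n, Continuous (f n))
    {R C : ℝ} (hC : ∀ n s, |s| ≤ R → |f n s| ≤ C)
    (hlim : ∀ s, |s| ≤ R → Tendsto (fun n => f n s) atTop (𝓝 (g s))) {r : ℝ} (hr : |r| ≤ R) :
    Tendsto (fun n => radialMean k (f n) r) atTop (𝓝 (radialMean k g r)) := by
  have h1 : ∀ t ∈ Set.uIoc (0 : ℝ) 1, |t| ≤ 1 ∧ |r * t| ≤ R := fun t ht => by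
    rw [Set.uIoc_of_le zero_le_one] at ht
    have : |t| ≤ 1 := by rw [abs_of_nonneg ht.1.le]; exact ht.2
    exact ⟨this, by
      rw [abs_mul]; exact (mul_le_of_le_one_right (abs_nonneg _) this).trans hr⟩
  refine intervalIntegral.tendsto_integral_filter_of_dominated_convergence (fun _ => C)
    (Eventually.of_forall fun n => ?_) (Eventually.of_forall fun n => ?_) (by simp) ?_
  · have := hf n
    exact Continuous.aestronglyMeasurable (by fun_prop)
  · refine Eventually.of_forall fun t ht => ?_
    rw [Real.norm_eq_abs, abs_mul, abs_pow]
    exact (mul_le_of_le_one_left (abs_nonneg _) (pow_le_one₀ (abs_nonneg _) (h1 t ht).1)).trans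
      (hC n _ (h1 t ht).2)
  · exact Eventually.of_forall fun t ht => (hlim _ (h1 t ht).2).const_mul _

theorem tendsto_radialPotential {N : ℕ} {f : ℕ → ℝ → ℝ} {g : ℝ → ℝ} (hf : ∀ n, Continuous (f n))
    {R C : ℝ} (hC : ∀ n s, |s| ≤ R → |f n s| ≤ C)
    (hlim : ∀ s, |s| ≤ R → Tendsto (fun n => f n s) atTop (𝓝 (g s))) {r : ℝ} (hr : |r| ≤ R) :
    Tendsto (fun n => radialPotential N (f n) r) atTop (𝓝 (radialPotential N g r)) :=
  (tendsto_radialMean (fun n => continuous_radialMean (hf n))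
    (fun n _ hs => abs_radialMean_le (hf n) (hC n) hs)
    (fun _ hs => tendsto_radialMean hf hC hlim hs) hr).const_mul _

/-! ### Derivatives and regularity of means and potentials. -/

/-- Undoing the rescaling gives an ordinary primitive, to which the fundamental theorem of calculus
applies even at the origin. -/
theorem pow_mul_radialMean (k : ℕ) (f : ℝ → ℝ) (r : ℝ) :
    r ^ (k + 1) * radialMean k f r = ∫ t in (0 : ℝ)..r, t ^ k * f t := by
  have h := intervalIntegral.smul_integral_comp_mul_left (a := 0) (b := 1)
    (fun t => t ^ k * f t) r
  simp only [mul_zero, mul_one, smul_eq_mul] at h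
  rw [← h, radialMean, pow_succ', mul_assoc, ← intervalIntegral.integral_const_mul]
  simp only [mul_pow, mul_assoc]

theorem hasDerivAt_pow_mul_radialMean (k : ℕ) {f : ℝ → ℝ} (hf : Continuous f) (r : ℝ) :
    HasDerivAt (fun r => r ^ (k + 1) * radialMean k f r) (r ^ k * f r) r := by
  simp only [pow_mul_radialMean]
  have hc : Continuous fun t => t ^ k * f t := by fun_prop
  exact intervalIntegral.integral_hasDerivAt_right (hc.intervalIntegrable _ _)
    hc.stronglyMeasurable.stronglyMeasurableAtFilter hc.continuousAt

theorem hasDerivAt_radialPotential {N : ℕ} {f : ℝ → ℝ} (hf : Continuous f) (r : ℝ) :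
    HasDerivAt (radialPotential N f) (r * radialMean (N - 1) f r) r := by
  simpa [← radialPotential.eq_def] using
    hasDerivAt_pow_mul_radialMean 1 (continuous_radialMean (k := N - 1) hf) r

theorem hasDerivAt_mul_radialMean {N : ℕ} (hN : 1 ≤ N) {f : ℝ → ℝ} (hf : Continuous f) (r : ℝ) :
    HasDerivAt (fun s => s * radialMean (N - 1) f s)
      (f r - ((N : ℝ) - 1) * radialMean (N - 1) f r) r := by
  obtain ⟨m, rfl⟩ : ∃ m, N = m + 1 := ⟨N - 1, by omega⟩
  simp only [Nat.add_sub_cancel, Nat.cast_add, Nat.cast_one, add_sub_cancel_right]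
  rcases eq_or_ne r 0 with rfl | hr
  · rw [radialMean_zero]
    -- At the origin the difference quotient of `s * radialMean m f s` is the mean itself, which is
    -- continuous.
    have h : HasDerivAt (fun s => s * radialMean m f s) (radialMean m f 0) 0 := by
      rw [hasDerivAt_iff_tendsto_slope]
      refine ((continuous_radialMean hf).tendsto 0 |>.mono_left nhdsWithin_le_nhds).congr' ?_
      filter_upwards [self_mem_nhdsWithin] with s hs
      have : s ≠ 0 := hs
      simp [slope_def_field, this]
    convert h using 1
    rw [radialMean_zero]
    field_simp
    ring
  · have h := (hasDerivAt_pow_mul_radialMean m hf r).div (hasDerivAt_pow m r) (pow_ne_zero m hr)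
    refine (h.congr_deriv ?_).congr_of_eventuallyEq ?_
    · rcases m with _ | m
      · simp
      · simp only [Nat.add_sub_cancel]
        field_simp
        push_cast
        ring
    · filter_upwards [isOpen_ne.mem_nhds hr] with s hs
      have : s ≠ 0 := hs
      simp only [Pi.div_apply]
      field_simp
      ring

/-- Differentiation under the integral brings out a factor `t`, so the exponent of the weight rises
by one; the induction in `contDiff_radialMean` therefore runs over all `k`. -/
theorem hasDerivAt_radialMean (k : ℕ) {f : ℝ → ℝ} (hf : ContDiff ℝ 1 f) (r : ℝ) :
    HasDerivAt (radialMean k f) (radialMean (k + 1) (deriv f) r) r := by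
  have hf0 := hf.continuous
  have hf1 : Continuous (deriv f) := hf.continuous_deriv le_rfl
  obtain ⟨C, hC⟩ := (isCompact_Icc (a := -(|r| + 1)) (b := |r| + 1)).exists_bound_of_continuousOn
    hf1.continuousOn
  refine (intervalIntegral.hasDerivAt_integral_of_dominated_loc_of_deriv_le
    (F := fun s t => t ^ k * f (s * t)) (F' := fun s t => t ^ (k + 1) * deriv f (s * t))
    (bound := fun _ => C) (Metric.ball_mem_nhds r one_pos) (Eventually.of_forall fun s => ?_)
    (radialMean_intervalIntegrable hf0 _ _ _) ?_ ?_ (by simp) ?_).2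
  · exact Continuous.aestronglyMeasurable (by fun_prop)
  · exact Continuous.aestronglyMeasurable (by fun_prop)
  · refine Eventually.of_forall fun t ht s hs => ?_
    rw [Set.uIoc_of_le zero_le_one] at ht
    rw [Metric.mem_ball, Real.dist_eq] at hs
    have h1 : |t| ≤ 1 := by rw [abs_of_nonneg ht.1.le]; exact ht.2
    have h2 : |s * t| ≤ |r| + 1 := by
      rw [abs_mul]
      have : |s| ≤ |r| + 1 := by linarith [abs_sub_abs_le_abs_sub s r]
      exact (mul_le_of_le_one_right (abs_nonneg _) h1).trans this
    rw [norm_mul, norm_pow]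
    exact (mul_le_of_le_one_left (norm_nonneg _) (pow_le_one₀ (norm_nonneg _) h1)).trans
      (hC _ (abs_le.1 h2))
  · refine Eventually.of_forall fun t _ s _ => ?_
    have h := ((hf.differentiable one_ne_zero (s * t)).hasDerivAt.comp s
      ((hasDerivAt_id s).mul_const t)).const_mul (t ^ k)
    refine h.congr_deriv ?_
    ring

theorem contDiff_radialMean (n : ℕ) (k : ℕ) {f : ℝ → ℝ} (hf : ContDiff ℝ n f) :
    ContDiff ℝ n (radialMean k f) := by
  induction n generalizing k f with
  | zero => exact contDiff_zero.2 (continuous_radialMean hf.continuous)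
  | succ n ih =>
    have h1 : ContDiff ℝ 1 f := hf.of_le (by exact_mod_cast Nat.le_add_left 1 n)
    rw [Nat.cast_add, Nat.cast_one, contDiff_succ_iff_deriv] at hf ⊢
    refine ⟨fun r => (hasDerivAt_radialMean k h1 r).differentiableAt, by simp, ?_⟩
    rw [show deriv (radialMean k f) = radialMean (k + 1) (deriv f) from
      funext fun r => (hasDerivAt_radialMean k h1 r).deriv]
    exact ih _ hf.2.2

theorem deriv_radialPotential (N : ℕ) {f : ℝ → ℝ} (hf : Continuous f) :
    deriv (radialPotential N f) = fun r => r * radialMean (N - 1) f r :=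
  funext fun r => (hasDerivAt_radialPotential hf r).deriv

theorem deriv_deriv_radialPotential {N : ℕ} (hN : 1 ≤ N) {f : ℝ → ℝ} (hf : Continuous f) :
    deriv (deriv (radialPotential N f)) = fun r => f r - ((N : ℝ) - 1) * radialMean (N - 1) f r := by
  rw [deriv_radialPotential N hf]
  exact funext fun r => (hasDerivAt_mul_radialMean hN hf r).deriv

theorem contDiff_radialPotential {N : ℕ} (hN : 1 ≤ N) (n : ℕ) {f : ℝ → ℝ} (hf : ContDiff ℝ n f) :
    ContDiff ℝ (n + 2) (radialPotential N f) := by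
  have hf0 := hf.continuous
  have hm := contDiff_radialMean n (N - 1) hf
  rw [show ((n : WithTop ℕ∞) + 2) = (n + 1) + 1 by rw [add_assoc, one_add_one_eq_two],
    contDiff_succ_iff_deriv]
  refine ⟨fun r => (hasDerivAt_radialPotential hf0 r).differentiableAt, by simp, ?_⟩
  rw [contDiff_succ_iff_deriv]
  refine ⟨fun r => ?_, by simp, ?_⟩
  · rw [deriv_radialPotential N hf0]
    exact (hasDerivAt_mul_radialMean hN hf0 r).differentiableAt
  · rw [deriv_deriv_radialPotential hN hf0]
    fun_prop

theorem radialLaplacian_const_add (N : ℕ) (c : ℝ) (f : ℝ → ℝ) :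
    radialLaplacian N (fun r => c + f r) = radialLaplacian N f := by
  have : deriv (fun r => c + f r) = deriv f := funext fun r => deriv_const_add c
  funext r
  simp only [radialLaplacian, this]

theorem radialLaplacian_radialPotential {N : ℕ} (hN : 1 ≤ N) {f : ℝ → ℝ} (hf : Continuous f) :
    radialLaplacian N (radialPotential N f) = f := by
  have : (N : ℝ) ≠ 0 := by positivity
  funext r
  rw [radialLaplacian, deriv_deriv_radialPotential hN hf, deriv_radialPotential N hf]
  split_ifs with h
  · simp only [h, radialMean_zero, Nat.cast_sub hN, Nat.cast_one, sub_add_cancel]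
    rw [show f 0 - ((N : ℝ) - 1) * (f 0 / N) = f 0 / N by field_simp; ring]
    exact mul_div_cancel₀ _ this
  · field_simp
    ring

/-! ### Equivalence of the differential and the integral formulation. -/

/-- The Laplacian of the solution, recovered from the integral equation. -/
noncomputable def integralLaplacian (N : ℕ) (β : ℝ) (u : ℝ → ℝ) (r : ℝ) : ℝ :=
  β + radialPotential N (fun s => Real.exp (u s)) r

/-- The integral equation equivalent to the initial value problem. -/
structure IsIntegralSolution (N : ℕ) (β : ℝ) (u : ℝ → ℝ) : Prop where
  even : ∀ r, u (-r) = u r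
  continuous : Continuous u
  eq : ∀ r, u r = radialPotential N (integralLaplacian N β u) r

theorem continuous_integralLaplacian {N : ℕ} {β : ℝ} {u : ℝ → ℝ} (hu : Continuous u) :
    Continuous (integralLaplacian N β u) :=
  continuous_const.add (continuous_radialPotential (Real.continuous_exp.comp hu))

theorem integralLaplacian_even {N : ℕ} {β : ℝ} {u : ℝ → ℝ} (hu : ∀ r, u (-r) = u r) (r : ℝ) :
    integralLaplacian N β u (-r) = integralLaplacian N β u r := by
  rw [integralLaplacian, radialPotential_even (fun r => by rw [hu]), integralLaplacian]

theorem IsIntegralSolution.isEntireRadialSolution {N : ℕ} (hN : 1 ≤ N) {β : ℝ} {u : ℝ → ℝ}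
    (h : IsIntegralSolution N β u) : IsEntireRadialSolution N β u := by
  have hu := h.continuous
  have hv := continuous_integralLaplacian (N := N) (β := β) hu
  have hu1 : u = radialPotential N (integralLaplacian N β u) := funext h.eq
  -- Bootstrap: `exp u` is continuous, so its potential is `C²`, and then `u`, the potential of a
  -- `C²` function, is `C⁴`.
  have hv2 : ContDiff ℝ 2 (integralLaplacian N β u) := by
    have h0 : ContDiff ℝ (0 : ℕ) fun s => Real.exp (u s) :=
      contDiff_zero.2 (Real.continuous_exp.comp hu)
    have := contDiff_radialPotential hN 0 h0
    norm_num at this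
    exact contDiff_const.add this
  have hlap : radialLaplacian N u = integralLaplacian N β u := by
    conv_lhs => rw [hu1]
    exact radialLaplacian_radialPotential hN hv
  refine ⟨h.even, ?_, fun r _ => ?_, ?_, ?_, ?_, ?_⟩
  · have := contDiff_radialPotential hN 2 hv2
    rw [← hu1] at this
    norm_num at this
    exact this
  · rw [hlap]
    exact congrFun ((radialLaplacian_const_add N β _).trans
      (radialLaplacian_radialPotential hN (Real.continuous_exp.comp hu))) r
  · rw [h.eq, radialPotential_zero]
  · rw [hlap, integralLaplacian, radialPotential_zero, add_zero]
  · rw [hu1, deriv_radialPotential N hv]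
    exact zero_mul _
  · rw [hlap]
    have := ((hasDerivAt_radialPotential (N := N) (Real.continuous_exp.comp hu) 0).const_add β).deriv
    rwa [zero_mul] at this

/-- A radial Poisson equation on `(0, ∞)` without singularity at the origin determines the
function from its value at `0`. -/
theorem eq_add_radialPotential {N : ℕ} (hN : 1 ≤ N) {f f' f'' g : ℝ → ℝ} (hf : Continuous f)
    (hg : Continuous g) (h1 : ∀ r, 0 < r → HasDerivAt f (f' r) r)
    (h2 : ∀ r, 0 < r → HasDerivAt f' (f'' r) r)
    (heq : ∀ r, 0 < r → f'' r + ((N : ℝ) - 1) / r * f' r = g r)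
    (h0 : Tendsto (fun r => r ^ (N - 1) * f' r) (𝓝[>] 0) (𝓝 0)) {r : ℝ} (hr : 0 ≤ r) :
    f r = f 0 + radialPotential N g r := by
  obtain ⟨m, rfl⟩ : ∃ m, N = m + 1 := ⟨N - 1, by omega⟩
  simp only [Nat.add_sub_cancel, Nat.cast_add, Nat.cast_one, add_sub_cancel_right] at *
  -- The functions `s^m f'` and `s^(m+1) radialMean m g` have the same derivative on `(0, ∞)` and
  -- both tend to `0` at the origin, so they agree.
  have hf' : ∀ s, 0 < s → f' s = s * radialMean m g s := by
    have hd : ∀ s, 0 < s → HasDerivAt (fun s => s ^ m * f' s - s ^ (m + 1) * radialMean m g s)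
        0 s := fun s hs => by
      refine (((hasDerivAt_pow m s).mul (h2 s hs)).sub
        (hasDerivAt_pow_mul_radialMean m hg s)).congr_deriv ?_
      rw [← heq s hs]
      rcases m with _ | m
      · simp
      · simp only [Nat.add_sub_cancel]
        push_cast
        field_simp
        ring
    have hlim : Tendsto (fun s => s ^ m * f' s - s ^ (m + 1) * radialMean m g s) (𝓝[>] 0)
        (𝓝 0) := by
      have hc : Continuous fun s : ℝ => s ^ (m + 1) * radialMean m g s :=
        (continuous_pow _).mul (continuous_radialMean hg)
      simpa using h0.sub ((hc.tendsto 0).mono_left nhdsWithin_le_nhds)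
    intro s hs
    have hconst : ∀ x ∈ Set.Ioi (0 : ℝ), x ^ m * f' x - x ^ (m + 1) * radialMean m g x =
        s ^ m * f' s - s ^ (m + 1) * radialMean m g s := fun x hx =>
      isOpen_Ioi.is_const_of_deriv_eq_zero isPreconnected_Ioi
        (fun y hy => (hd y hy).differentiableAt.differentiableWithinAt)
        (fun y hy => (hd y hy).deriv) hx hs
    have := tendsto_nhds_unique (hlim.congr' (by
      filter_upwards [self_mem_nhdsWithin] with x hx using hconst x hx)) tendsto_const_nhds
    have hsm : s ^ m ≠ 0 := (pow_pos hs m).ne'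
    refine mul_left_cancel₀ hsm ?_
    rw [pow_succ] at this
    linarith
  have hT := continuous_radialPotential (N := m + 1) hg
  rcases hr.eq_or_lt with rfl | hr
  · simp [radialPotential_zero]
  obtain ⟨c, hc, hc'⟩ := exists_hasDerivAt_eq_slope
    (fun s => f s - radialPotential (m + 1) g s) (fun _ => 0) hr (hf.sub hT).continuousOn
    fun s hs => ((h1 s hs.1).sub (hasDerivAt_radialPotential hg s)).congr_deriv (by
      rw [hf' s hs.1]; simp)
  rw [eq_comm, div_eq_zero_iff, radialPotential_zero] at hc'
  rcases hc' with h | h <;> linarith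

theorem IsEntireRadialSolution.contDiff_deriv {N : ℕ} {β : ℝ} {u : ℝ → ℝ}
    (h : IsEntireRadialSolution N β u) : ContDiff ℝ 3 (deriv u) := by
  have h4 := h.contDiff
  rw [show (4 : WithTop ℕ∞) = 3 + 1 by norm_num, contDiff_succ_iff_deriv] at h4
  exact h4.2.2

theorem IsEntireRadialSolution.continuous_radialLaplacian {N : ℕ} {β : ℝ} {u : ℝ → ℝ}
    (h : IsEntireRadialSolution N β u) : Continuous (radialLaplacian N u) := by
  have hu' : Continuous (deriv u) := h.contDiff.continuous_deriv (by norm_num)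
  have hd1 : ContDiff ℝ 3 (deriv u) := h.contDiff_deriv
  have hu'' : Continuous (deriv (deriv u)) := hd1.continuous_deriv (by norm_num)
  rw [continuous_iff_continuousAt]
  intro r
  rcases eq_or_ne r 0 with rfl | hr
  · rw [continuousAt_iff_punctured_nhds]
    -- Since `u'(0) = 0`, the quotient `u'(r)/r` is a slope of `u'` and tends to `u''(0)`; the total
    -- limit is `N u''(0)`.
    have hs := (hd1.differentiable (by norm_num) 0).hasDerivAt.tendsto_slope
    have h1 : Tendsto (fun r => deriv (deriv u) r + ((N : ℝ) - 1) * slope (deriv u) 0 r)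
        (𝓝[≠] 0) (𝓝 (radialLaplacian N u 0)) := by
      have := ((hu''.tendsto 0).mono_left nhdsWithin_le_nhds).add (hs.const_mul ((N : ℝ) - 1))
      convert this using 2
      simp [radialLaplacian]
      ring
    refine h1.congr' ?_
    filter_upwards [self_mem_nhdsWithin] with r hr
    have hr : r ≠ 0 := hr
    simp [radialLaplacian, hr, slope_def_field, h.deriv_zero]
    ring
  · have hc : ContinuousAt (fun r => deriv (deriv u) r + ((N : ℝ) - 1) / r * deriv u r) r := by
      fun_prop (disch := exact hr)
    refine hc.congr ?_
    filter_upwards [isOpen_ne.mem_nhds hr] with s hs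
    rw [radialLaplacian, if_neg hs]

theorem IsEntireRadialSolution.radialLaplacian_even {N : ℕ} {β : ℝ} {u : ℝ → ℝ}
    (h : IsEntireRadialSolution N β u) (r : ℝ) :
    radialLaplacian N u (-r) = radialLaplacian N u r := by
  have h1 : ∀ r, deriv u (-r) = -deriv u r := fun r => by
    have := deriv_comp_neg u r
    rw [show (fun x => u (-x)) = u from funext h.even] at this
    rw [this, neg_neg]
  have h2 : deriv (deriv u) (-r) = deriv (deriv u) r := by
    have := deriv_comp_neg (deriv u) r
    rw [show (fun x => deriv u (-x)) = fun x => - deriv u x from funext h1] at this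
    simpa using this.symm
  simp only [radialLaplacian, h1, h2, neg_eq_zero]
  split_ifs <;> ring

/-- Classical entire radial solutions solve the integral equation. -/
theorem IsEntireRadialSolution.radialLaplacian_eq {N : ℕ} (hN : 3 ≤ N) {β : ℝ} {u : ℝ → ℝ}
    (h : IsEntireRadialSolution N β u) :
    radialLaplacian N u = integralLaplacian N β u := by
  have hv := h.continuous_radialLaplacian
  have hu0 : Continuous fun s => Real.exp (u s) := Real.continuous_exp.comp h.contDiff.continuous
  have hd1 : ContDiff ℝ 3 (deriv u) := h.contDiff_deriv
  have hd2 : ContDiff ℝ 2 (deriv (deriv u)) := by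
    have h3 := hd1
    rw [show (3 : WithTop ℕ∞) = 2 + 1 by norm_num, contDiff_succ_iff_deriv] at h3
    exact h3.2.2
  have hc3 : Continuous (deriv (deriv (deriv u))) := hd2.continuous_deriv (by norm_num)
  have hC2 : ∀ r, 0 < r → ContDiffAt ℝ 2 (radialLaplacian N u) r := fun r hr => by
    have : ContDiffAt ℝ 2 (fun r => deriv (deriv u) r + ((N : ℝ) - 1) / r * deriv u r) r :=
      hd2.contDiffAt.add ((contDiffAt_const.div contDiffAt_id hr.ne').mul
        (hd1.of_le (by norm_num)).contDiffAt)
    refine this.congr_of_eventuallyEq ?_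
    filter_upwards [isOpen_ne.mem_nhds hr.ne'] with s hs
    rw [radialLaplacian, if_neg hs]
  have h1 : ∀ r, 0 < r → HasDerivAt (radialLaplacian N u) (deriv (radialLaplacian N u) r) r :=
    fun r hr => ((hC2 r hr).differentiableAt (by norm_num)).hasDerivAt
  have h2 : ∀ r, 0 < r → HasDerivAt (deriv (radialLaplacian N u))
      (deriv (deriv (radialLaplacian N u)) r) r := fun r hr => by
    have := ((hC2 r hr).fderiv_right (m := 1) (by norm_num)).differentiableAt one_ne_zero
    exact (this.clm_apply (differentiableAt_const (1 : ℝ))).hasDerivAt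
  have hder : ∀ r, 0 < r → deriv (radialLaplacian N u) r = deriv (deriv (deriv u)) r +
      ((N : ℝ) - 1) * (deriv (deriv u) r / r - deriv u r / r ^ 2) := fun r hr => by
    have : HasDerivAt (fun r => deriv (deriv u) r + ((N : ℝ) - 1) * (deriv u r / r))
        (deriv (deriv (deriv u)) r +
          ((N : ℝ) - 1) * (deriv (deriv u) r / r - deriv u r / r ^ 2)) r := by
      refine ((hd2.differentiable (by norm_num) r).hasDerivAt.add
        (((hd1.differentiable (by norm_num) r).hasDerivAt.div (hasDerivAt_id r)
          hr.ne').const_mul _)).congr_deriv ?_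
      simp only [id, mul_one]
      field_simp
    refine (this.congr_of_eventuallyEq ?_).deriv
    filter_upwards [isOpen_ne.mem_nhds hr.ne'] with s hs
    rw [radialLaplacian, if_neg hs]
    ring
  -- The factor `r^(N-1) = r^(N-3) r²` clears the denominators in `(Δu)'`; this needs `N ≥ 3`, and
  -- what remains vanishes at the origin because `u'(0) = 0`.
  have h0 : Tendsto (fun r => r ^ (N - 1) * deriv (radialLaplacian N u) r) (𝓝[>] 0) (𝓝 0) := by
    have hc : Continuous fun r => r ^ (N - 3) * (r ^ 2 * deriv (deriv (deriv u)) r +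
        ((N : ℝ) - 1) * (r * deriv (deriv u) r - deriv u r)) := by
      have := hd1.continuous
      have := hd2.continuous
      fun_prop
    have := (hc.tendsto 0).mono_left (nhdsWithin_le_nhds (s := Set.Ioi 0))
    simp only [h.deriv_zero, ne_eq, OfNat.ofNat_ne_zero, not_false_eq_true, zero_pow, zero_mul,
      sub_zero, mul_zero, add_zero] at this
    refine this.congr' ?_
    filter_upwards [self_mem_nhdsWithin] with r hr
    have hr : 0 < r := hr
    rw [hder r hr, show N - 1 = N - 3 + 2 by omega, pow_add]
    field_simp
  have key : ∀ r, 0 ≤ r → radialLaplacian N u r = integralLaplacian N β u r := fun r hr => by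
    rw [integralLaplacian, ← h.laplacian_zero]
    refine eq_add_radialPotential (by omega) hv hu0 h1 h2 (fun r hr => ?_) h0 hr
    rw [← h.equation r hr.le]
    conv_rhs => rw [radialLaplacian, if_neg hr.ne']
  funext r
  rcases le_total 0 r with hr | hr
  · exact key r hr
  · rw [← h.radialLaplacian_even, ← integralLaplacian_even h.even]
    exact key _ (by linarith)

theorem IsEntireRadialSolution.isIntegralSolution {N : ℕ} (hN : 3 ≤ N) {β : ℝ} {u : ℝ → ℝ}
    (h : IsEntireRadialSolution N β u) : IsIntegralSolution N β u := by
  refine ⟨h.even, h.contDiff.continuous, fun r => ?_⟩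
  have hd1 : ContDiff ℝ 3 (deriv u) := h.contDiff_deriv
  have key : ∀ r, 0 ≤ r → u r = radialPotential N (integralLaplacian N β u) r := fun r hr => by
    have := eq_add_radialPotential (by omega : 1 ≤ N) h.contDiff.continuous
      h.continuous_radialLaplacian
      (fun r _ => (h.contDiff.differentiable (by norm_num) r).hasDerivAt)
      (fun r _ => (hd1.differentiable (by norm_num) r).hasDerivAt)
      (fun r hr => by rw [radialLaplacian, if_neg hr.ne']) ?_ hr
    · rwa [h.value_zero, zero_add, h.radialLaplacian_eq hN] at this
    · have hc : Continuous fun r => r ^ (N - 1) * deriv u r := by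
        have := hd1.continuous
        fun_prop
      have := (hc.tendsto 0).mono_left (nhdsWithin_le_nhds (s := Set.Ioi 0))
      simpa [h.deriv_zero] using this
  rcases le_total 0 r with hr | hr
  · exact key r hr
  · rw [← h.even, ← radialPotential_even (integralLaplacian_even h.even)]
    exact key _ (by linarith)

/-! ### Growth estimates, finite-radius blow-up and the sign of the Laplacian. -/

theorem le_of_hasDerivAt_le {f g f' g' : ℝ → ℝ} {a : ℝ} (hf : ∀ s, a ≤ s → HasDerivAt f (f' s) s)
    (hg : ∀ s, a ≤ s → HasDerivAt g (g' s) s) (h : ∀ s, a ≤ s → f' s ≤ g' s) (h0 : f a ≤ g a)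
    {s : ℝ} (hs : a ≤ s) : f s ≤ g s := by
  have hd : ∀ x, a ≤ x → HasDerivAt (fun y => g y - f y) (g' x - f' x) x :=
    fun x hx => (hg x hx).sub (hf x hx)
  have hm : MonotoneOn (fun y => g y - f y) (Set.Ici a) :=
    monotoneOn_of_hasDerivWithinAt_nonneg (convex_Ici a)
      (fun x hx => (hd x hx).continuousAt.continuousWithinAt)
      (fun x hx => (hd x (interior_subset hx)).hasDerivWithinAt)
      (fun x hx => sub_nonneg.2 (h x (interior_subset hx)))
  have := hm (Set.self_mem_Ici (a := a)) hs hs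
  simp only at this
  linarith

theorem pow_mul_radialMean_ge {m : ℕ} {f : ℝ → ℝ} (hf : Continuous f) {ρ K : ℝ} (hρ : 0 ≤ ρ)
    (hfK : ∀ s, ρ ≤ s → K ≤ f s) {s : ℝ} (hs : ρ ≤ s) :
    ρ ^ (m + 1) * radialMean m f ρ + K * (s ^ (m + 1) - ρ ^ (m + 1)) / (m + 1) ≤
      s ^ (m + 1) * radialMean m f s := by
  refine le_of_hasDerivAt_le
    (f := fun s => ρ ^ (m + 1) * radialMean m f ρ + K * (s ^ (m + 1) - ρ ^ (m + 1)) / (m + 1))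
    (f' := fun s => s ^ m * K) (fun s _ => ?_)
    (fun s _ => hasDerivAt_pow_mul_radialMean m hf s) (fun s hs => ?_) (by simp) hs
  · refine (((((hasDerivAt_pow (m + 1) s).sub_const _).const_mul K).div_const _).const_add
      _).congr_deriv ?_
    simp only [Nat.add_sub_cancel]
    push_cast
    field_simp
  · exact mul_le_mul_of_nonneg_left (hfK s hs) (pow_nonneg (hρ.trans hs) _)

/-- The mass in `[0, ρ]` is nonnegative and is dropped; the rest uses `s^(m+1) - ρ^(m+1) ≥ s^m (s -
ρ)`. -/
theorem mul_radialMean_ge {N : ℕ} (hN : 1 ≤ N) {f : ℝ → ℝ} (hf : Continuous f) {ρ K : ℝ}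
    (hρ : 0 ≤ ρ) (hK : 0 ≤ K) (hfK : ∀ s, ρ ≤ s → K ≤ f s) (h0 : 0 ≤ radialMean (N - 1) f ρ)
    {s : ℝ} (hs : ρ ≤ s) : K * (s - ρ) / N ≤ s * radialMean (N - 1) f s := by
  obtain ⟨m, rfl⟩ : ∃ m, N = m + 1 := ⟨N - 1, by omega⟩
  simp only [Nat.add_sub_cancel, Nat.cast_add, Nat.cast_one] at *
  rcases (hρ.trans hs).eq_or_lt with rfl | hs0
  · simp [le_antisymm hs hρ]
  have h := pow_mul_radialMean_ge (m := m) hf hρ hfK hs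
  have h1 : 0 ≤ ρ ^ (m + 1) * radialMean m f ρ := mul_nonneg (pow_nonneg hρ _) h0
  have h2 : s ^ m * (s - ρ) ≤ s ^ (m + 1) - ρ ^ (m + 1) := by
    have : ρ ^ m * ρ ≤ s ^ m * ρ := mul_le_mul_of_nonneg_right (pow_le_pow_left₀ hρ hs m) hρ
    rw [pow_succ, pow_succ]
    linarith
  have h3 : s ^ m * (K * (s - ρ) / (m + 1)) ≤ K * (s ^ (m + 1) - ρ ^ (m + 1)) / (m + 1) := by
    rw [← mul_div_assoc]
    refine div_le_div_of_nonneg_right ?_ (by positivity)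
    linarith [mul_le_mul_of_nonneg_left h2 hK]
  refine le_of_mul_le_mul_left ?_ (pow_pos hs0 m)
  calc _ ≤ s ^ (m + 1) * radialMean m f s := by linarith
    _ = _ := by ring

theorem radialMean_nonneg_of_le {N : ℕ} (hN : 1 ≤ N) {f : ℝ → ℝ} (hf : Continuous f) {ρ : ℝ}
    (hρ : 0 ≤ ρ) (hfρ : ∀ s, ρ ≤ s → 0 ≤ f s) (h0 : 0 ≤ radialMean (N - 1) f ρ)
    {s : ℝ} (hs : ρ ≤ s) : 0 ≤ radialMean (N - 1) f s := by
  rcases (hρ.trans hs).eq_or_lt with rfl | hs0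
  · rwa [le_antisymm hs hρ] at h0
  have := mul_radialMean_ge hN hf hρ le_rfl hfρ h0 hs
  rw [zero_mul, zero_div] at this
  exact nonneg_of_mul_nonneg_right this hs0

theorem radialPotential_ge {N : ℕ} (hN : 1 ≤ N) {f : ℝ → ℝ} (hf : Continuous f) {ρ K : ℝ}
    (hρ : 0 ≤ ρ) (hK : 0 ≤ K) (hfK : ∀ s, ρ ≤ s → K ≤ f s) (h0 : 0 ≤ radialMean (N - 1) f ρ)
    {s : ℝ} (hs : ρ ≤ s) :
    radialPotential N f ρ + K * (s - ρ) ^ 2 / (2 * N) ≤ radialPotential N f s := by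
  refine le_of_hasDerivAt_le (f := fun s => radialPotential N f ρ + K * (s - ρ) ^ 2 / (2 * N))
    (f' := fun s => K * (s - ρ) / N) (fun s _ => ?_) (fun s _ => hasDerivAt_radialPotential hf s)
    (fun s hs => mul_radialMean_ge hN hf hρ hK hfK h0 hs) (by simp) hs
  refine ((((((hasDerivAt_id s).sub_const ρ).pow 2).const_mul K).div_const _).const_add
    _).congr_deriv ?_
  have : (N : ℝ) ≠ 0 := by positivity
  simp
  field_simp

theorem monotoneOn_integralLaplacian {N : ℕ} (hN : 1 ≤ N) {β : ℝ} {u : ℝ → ℝ} (hu : Continuous u) :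
    MonotoneOn (integralLaplacian N β u) (Set.Ici 0) := by
  intro r hr s hs hrs
  have he : Continuous fun s => Real.exp (u s) := Real.continuous_exp.comp hu
  have := radialPotential_ge hN he hr le_rfl (fun s _ => (Real.exp_pos _).le)
    (radialMean_nonneg he fun t _ => (Real.exp_pos _).le) hrs
  simp only [integralLaplacian]
  simp only [zero_mul, zero_div] at this
  linarith

/-- Once the Laplacian and its mean are nonnegative, the solution blows up in finite time. -/
theorem IsIntegralSolution.false_of_nonneg {N : ℕ} (hN : 1 ≤ N) {β : ℝ} {u : ℝ → ℝ}
    (h : IsIntegralSolution N β u) {ρ₀ : ℝ} (hρ₀ : 0 ≤ ρ₀)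
    (hv : ∀ s, ρ₀ ≤ s → 0 ≤ integralLaplacian N β u s)
    (hm : 0 ≤ radialMean (N - 1) (integralLaplacian N β u) ρ₀) : False := by
  have hN0 : (0 : ℝ) < N := by exact_mod_cast hN
  have hvc := continuous_integralLaplacian (N := N) (β := β) h.continuous
  have he : Continuous fun s => Real.exp (u s) := Real.continuous_exp.comp h.continuous
  have hmean : ∀ s, ρ₀ ≤ s → 0 ≤ radialMean (N - 1) (integralLaplacian N β u) s :=
    fun s hs => radialMean_nonneg_of_le hN hvc hρ₀ hv hm hs
  have hu : ∀ K, 0 ≤ K → ∀ ρ, ρ₀ ≤ ρ → (∀ s, ρ ≤ s → K ≤ integralLaplacian N β u s) →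
      ∀ s, ρ ≤ s → u ρ + K * (s - ρ) ^ 2 / (2 * N) ≤ u s := fun K hK ρ hρ hvK s hs => by
    rw [h.eq, h.eq s]
    exact radialPotential_ge hN hvc (hρ₀.trans hρ) hK hvK (hmean ρ hρ) hs
  have hmono : ∀ ρ, ρ₀ ≤ ρ → ∀ s, ρ ≤ s → u ρ ≤ u s := fun ρ hρ s hs => by
    simpa using hu 0 le_rfl ρ hρ (fun s hs => hv s (hρ.trans hs)) s hs
  -- On the first length `d` the source `exp u ≥ exp (u ρ)` lifts the Laplacian; on the second this
  -- Laplacian lifts `u`.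
  have step : ∀ ρ, ρ₀ ≤ ρ → ∀ d, 0 ≤ d →
      u ρ + Real.exp (u ρ) * d ^ 4 / (4 * N ^ 2) ≤ u (ρ + 2 * d) := fun ρ hρ d hd => by
    have h1 : ∀ s, ρ + d ≤ s → Real.exp (u ρ) * d ^ 2 / (2 * N) ≤ integralLaplacian N β u s :=
      fun s hs => by
        have h2 := radialPotential_ge hN he (hρ₀.trans hρ) (Real.exp_pos (u ρ)).le
          (fun s hs => Real.exp_le_exp.2 (hmono ρ hρ s hs))
          (radialMean_nonneg he fun t _ => (Real.exp_pos _).le) (show ρ ≤ s by linarith)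
        have h3 := hv ρ hρ
        have h4 : Real.exp (u ρ) * d ^ 2 / (2 * N) ≤ Real.exp (u ρ) * (s - ρ) ^ 2 / (2 * N) := by
          gcongr
          linarith
        simp only [integralLaplacian] at h3 ⊢
        linarith
    have h5 := hu _ (by positivity) (ρ + d) (by linarith) h1 (ρ + 2 * d) (by linarith)
    have h6 := hmono ρ hρ (ρ + d) (by linarith)
    have h7 : Real.exp (u ρ) * d ^ 4 / (4 * N ^ 2) =
        Real.exp (u ρ) * d ^ 2 / (2 * N) * (ρ + 2 * d - (ρ + d)) ^ 2 / (2 * N) := by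
      field_simp
      ring
    linarith
  -- With `q⁴ = exp (-1)`, steps of length proportional to `q^k` lose in `d⁴` exactly what `exp u`
  -- gains when `u` rises by one per step. Their total length is at most `B`.
  set q : ℝ := Real.exp (-(1 / 4)) with hq
  have hq1 : q < 1 := Real.exp_lt_one_iff.2 (by norm_num)
  have hq0 : 0 < q := Real.exp_pos _
  set c : ℝ := Real.exp (u ρ₀) * (1 - q) ^ 4 / (64 * N ^ 2) with hc
  have hc0 : 0 < c := by
    have : 0 < 1 - q := by linarith
    positivity
  obtain ⟨B, hB1, hBc⟩ : ∃ B : ℝ, 1 ≤ B ∧ 1 ≤ c * B ^ 4 := by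
    refine ⟨max 1 (1 / c), le_max_left _ _, ?_⟩
    have h1 : 1 ≤ max 1 (1 / c) := le_max_left _ _
    have h2 : max 1 (1 / c) ≤ max 1 (1 / c) ^ 4 := le_self_pow₀ h1 (by norm_num)
    have h3 : 1 / c ≤ max 1 (1 / c) ^ 4 := (le_max_right _ _).trans h2
    rw [div_le_iff₀ hc0] at h3
    linarith
  have hqk : ∀ k : ℕ, Real.exp k * (q ^ k) ^ 4 = 1 := fun k => by
    rw [hq, ← Real.exp_nat_mul, ← Real.exp_nat_mul, ← Real.exp_add]
    convert Real.exp_zero using 2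
    push_cast
    ring
  have hq_le : ∀ k : ℕ, q ^ k ≤ 1 := fun k => pow_le_one₀ hq0.le hq1.le
  have claim : ∀ k : ℕ, u ρ₀ + k ≤ u (ρ₀ + B * (1 - q ^ k)) := by
    intro k
    induction k with
    | zero => simp
    | succ k ih =>
      have hρ : ρ₀ ≤ ρ₀ + B * (1 - q ^ k) := by nlinarith [hq_le k]
      have hd : 0 ≤ B * q ^ k * (1 - q) / 2 := by
        have : 0 ≤ 1 - q := by linarith
        positivity
      have h1 := step _ hρ _ hd
      have h2 : (1 : ℝ) ≤ Real.exp (u (ρ₀ + B * (1 - q ^ k))) *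
          (B * q ^ k * (1 - q) / 2) ^ 4 / (4 * N ^ 2) :=
        calc (1 : ℝ) ≤ c * B ^ 4 * (Real.exp k * (q ^ k) ^ 4) := by rwa [hqk, mul_one]
          _ = Real.exp (u ρ₀ + k) * (B * q ^ k * (1 - q) / 2) ^ 4 / (4 * N ^ 2) := by
            rw [hc, Real.exp_add]
            field_simp
            ring
          _ ≤ _ := by gcongr
      have h3 : ρ₀ + B * (1 - q ^ k) + 2 * (B * q ^ k * (1 - q) / 2) =
          ρ₀ + B * (1 - q ^ (k + 1)) := by ring
      rw [h3] at h1
      push_cast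
      linarith
  obtain ⟨k, hk⟩ := exists_nat_gt (u (ρ₀ + B) - u ρ₀)
  have h1 := hmono (ρ₀ + B * (1 - q ^ k)) (by nlinarith [hq_le k]) (ρ₀ + B)
    (by nlinarith [pow_pos hq0 k])
  linarith [claim k]

/-- A positive value `c` persists by monotonicity, and the positive mass accumulated afterwards
outweighs any negative mass `E` before `r`; from there on the blow-up argument applies. -/
theorem IsIntegralSolution.laplacian_nonpos {N : ℕ} (hN : 1 ≤ N) {β : ℝ} {u : ℝ → ℝ}
    (h : IsIntegralSolution N β u) {r : ℝ} (hr : 0 ≤ r) : integralLaplacian N β u r ≤ 0 := by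
  by_contra! hc
  have hvc := continuous_integralLaplacian (N := N) (β := β) h.continuous
  have hge : ∀ s, r ≤ s → integralLaplacian N β u r ≤ integralLaplacian N β u s := fun s hs =>
    monotoneOn_integralLaplacian hN h.continuous hr (hr.trans hs : (0 : ℝ) ≤ s) hs
  set c := integralLaplacian N β u r with hcdef
  obtain ⟨m, rfl⟩ : ∃ m, N = m + 1 := ⟨N - 1, by omega⟩
  set E := r ^ (m + 1) * radialMean m (integralLaplacian (m + 1) β u) r with hE
  -- `F` is the amount needed to compensate `|E|`; the extra `1` in `r + F + 1` makes the base at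
  -- least `1`, so that its power dominates it.
  set F := r ^ (m + 1) + |E| * (m + 1) / c with hF
  have hF0 : 0 ≤ F := by positivity
  have hs : r ≤ r + F + 1 := by linarith
  refine h.false_of_nonneg hN (ρ₀ := r + F + 1) (by linarith)
    (fun s hs' => hc.le.trans (hge s (hs.trans hs'))) ?_
  have h1 := pow_mul_radialMean_ge (m := m) hvc hr hge hs
  have h2 : r + F + 1 ≤ (r + F + 1) ^ (m + 1) := le_self_pow₀ (by linarith) (by omega)
  have h3 : |E| ≤ c * ((r + F + 1) ^ (m + 1) - r ^ (m + 1)) / (m + 1) := by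
    rw [le_div_iff₀ (by positivity)]
    have : |E| * (m + 1) / c ≤ (r + F + 1) ^ (m + 1) - r ^ (m + 1) := by linarith
    rw [div_le_iff₀ hc] at this
    linarith
  have h4 : 0 ≤ (r + F + 1) ^ (m + 1) * radialMean m (integralLaplacian (m + 1) β u) (r + F + 1) := by
    linarith [neg_abs_le E]
  exact nonneg_of_mul_nonneg_right h4 (by positivity)

theorem IsIntegralSolution.nonpos {N : ℕ} (hN : 1 ≤ N) {β : ℝ} {u : ℝ → ℝ}
    (h : IsIntegralSolution N β u) (r : ℝ) : u r ≤ 0 := by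
  have key : ∀ r, 0 ≤ r → u r ≤ 0 := fun r hr => by
    have := radialPotential_mono (N := N) (r := r)
      (continuous_integralLaplacian (N := N) (β := β) h.continuous) (continuous_const (y := (0 : ℝ)))
      fun t ht => h.laplacian_nonpos hN (mul_nonneg hr ht.1)
    rwa [radialPotential_const hN, ← h.eq, zero_mul, zero_div] at this
  rcases le_total 0 r with hr | hr
  · exact key r hr
  · rw [← h.even]
    exact key _ (by linarith)

theorem IsIntegralSolution.exists_tendsto_laplacian {N : ℕ} (hN : 1 ≤ N) {β : ℝ} {u : ℝ → ℝ}
    (h : IsIntegralSolution N β u) :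
    ∃ σ ≤ 0, Tendsto (integralLaplacian N β u) atTop (𝓝 σ) ∧
      ∀ r, 0 ≤ r → integralLaplacian N β u r ≤ σ := by
  -- The Laplacian is monotone only on `[0, ∞)`; truncating the argument at `0` makes it monotone on
  -- `ℝ`.
  have hm : Monotone fun r => integralLaplacian N β u (max r 0) := fun r s hrs =>
    monotoneOn_integralLaplacian hN h.continuous (le_max_right r 0) (le_max_right s 0)
      (max_le_max_right 0 hrs)
  have hb : BddAbove (Set.range fun r => integralLaplacian N β u (max r 0)) :=
    ⟨0, by rintro _ ⟨r, rfl⟩; exact h.laplacian_nonpos hN (le_max_right r 0)⟩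
  have ht := (tendsto_atTop_ciSup hm hb).congr' (f₂ := integralLaplacian N β u) (by
    filter_upwards [eventually_ge_atTop 0] with r hr
    rw [max_eq_left hr])
  refine ⟨_, ciSup_le fun r => h.laplacian_nonpos hN (le_max_right r 0), ht, fun r hr => ?_⟩
  have := le_ciSup hb r
  simpa [max_eq_left hr] using this

/-! ### Comparison of solutions with different parameters. -/

theorem IsIntegralSolution.le_of_laplacian_le {N : ℕ} {β₁ β₂ : ℝ} {u₁ u₂ : ℝ → ℝ}
    (h₁ : IsIntegralSolution N β₁ u₁) (h₂ : IsIntegralSolution N β₂ u₂) {r : ℝ} (hr : 0 ≤ r)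
    (h : ∀ s ∈ Set.Icc 0 r, integralLaplacian N β₁ u₁ s ≤ integralLaplacian N β₂ u₂ s) :
    u₁ r ≤ u₂ r := by
  rw [h₁.eq, h₂.eq]
  exact radialPotential_mono (continuous_integralLaplacian h₁.continuous)
    (continuous_integralLaplacian h₂.continuous) fun t ht =>
      h _ ⟨mul_nonneg hr ht.1, mul_le_of_le_one_right hr ht.2⟩

theorem integralLaplacian_sub_ge {N : ℕ} {β₁ β₂ : ℝ} {u₁ u₂ : ℝ → ℝ} (h₁ : Continuous u₁)
    (h₂ : Continuous u₂) {r : ℝ} (hr : 0 ≤ r) (h : ∀ s ∈ Set.Icc 0 r, u₁ s ≤ u₂ s) :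
    β₂ - β₁ ≤ integralLaplacian N β₂ u₂ r - integralLaplacian N β₁ u₁ r := by
  have := radialPotential_mono (N := N) (r := r) (Real.continuous_exp.comp h₁)
    (Real.continuous_exp.comp h₂) fun t ht =>
      Real.exp_le_exp.2 (h _ ⟨mul_nonneg hr ht.1, mul_le_of_le_one_right hr ht.2⟩)
  simp only [integralLaplacian]
  simp only [Function.comp_def] at this
  linarith

/-- Continuation argument: at the first point where the difference `z` falls to half its initial
value, `z ≥ 0` has held so far, hence `u₁ ≤ u₂` there, which forces `z ≥ β₂ - β₁`. -/
theorem IsIntegralSolution.laplacian_lt {N : ℕ} {β₁ β₂ : ℝ} {u₁ u₂ : ℝ → ℝ}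
    (h₁ : IsIntegralSolution N β₁ u₁) (h₂ : IsIntegralSolution N β₂ u₂) (hβ : β₁ < β₂) {r : ℝ}
    (hr : 0 ≤ r) : integralLaplacian N β₁ u₁ r < integralLaplacian N β₂ u₂ r := by
  set z : ℝ → ℝ := fun r => integralLaplacian N β₂ u₂ r - integralLaplacian N β₁ u₁ r with hz
  have hzc : Continuous z := (continuous_integralLaplacian h₂.continuous).sub
    (continuous_integralLaplacian h₁.continuous)
  have hz0 : z 0 = β₂ - β₁ := by simp [hz, integralLaplacian, radialPotential_zero]
  by_contra! hc
  set S : Set ℝ := Set.Ici 0 ∩ z ⁻¹' Set.Iic ((β₂ - β₁) / 2) with hS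
  have hSc : IsClosed S := isClosed_Ici.inter (isClosed_Iic.preimage hzc)
  have hSn : S.Nonempty := ⟨r, hr, by
    simp only [hz, Set.mem_preimage, Set.mem_Iic]
    linarith⟩
  have hSb : BddBelow S := ⟨0, fun _ hx => hx.1⟩
  obtain ⟨hs0, hs1⟩ := hSc.csInf_mem hSn hSb
  set s := sInf S with hs
  have hs0 : 0 ≤ s := hs0
  have hs1 : z s ≤ (β₂ - β₁) / 2 := hs1
  have hlt : ∀ x, 0 ≤ x → x < s → (β₂ - β₁) / 2 < z x := fun x hx hxs => by
    by_contra! hle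
    exact absurd (csInf_le hSb ⟨hx, hle⟩) (not_le.2 hxs)
  have hzs : 0 ≤ z s := by
    by_contra! hneg
    obtain ⟨x, hx, hx0⟩ := intermediate_value_Icc' hs0 hzc.continuousOn
      (show (0 : ℝ) ∈ Set.Icc (z s) (z 0) from ⟨hneg.le, by linarith⟩)
    rcases hx.2.eq_or_lt with rfl | hxs
    · linarith
    · linarith [hlt x hx.1 hxs]
  have hpos : ∀ x ∈ Set.Icc 0 s, integralLaplacian N β₁ u₁ x ≤ integralLaplacian N β₂ u₂ x :=
    fun x hx => sub_nonneg.1 <| by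
      rcases hx.2.eq_or_lt with rfl | hxs
      · exact hzs
      · exact (by linarith : (0 : ℝ) ≤ (β₂ - β₁) / 2).trans (hlt x hx.1 hxs).le
  have := integralLaplacian_sub_ge (N := N) (β₁ := β₁) (β₂ := β₂) h₁.continuous h₂.continuous hs0
    fun x hx => h₁.le_of_laplacian_le h₂ hx.1 fun y hy => hpos y ⟨hy.1, hy.2.trans hx.2⟩
  linarith

theorem IsIntegralSolution.le_of_lt {N : ℕ} {β₁ β₂ : ℝ} {u₁ u₂ : ℝ → ℝ}
    (h₁ : IsIntegralSolution N β₁ u₁) (h₂ : IsIntegralSolution N β₂ u₂) (hβ : β₁ < β₂) (r : ℝ) :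
    u₁ r ≤ u₂ r := by
  have key : ∀ r, 0 ≤ r → u₁ r ≤ u₂ r := fun r hr =>
    h₁.le_of_laplacian_le h₂ hr fun s hs => (h₁.laplacian_lt h₂ hβ hs.1).le
  rcases le_total 0 r with hr | hr
  · exact key r hr
  · rw [← h₁.even, ← h₂.even]
    exact key _ (by linarith)

/-- The Laplacians of two entire solutions are at least as far apart as at the origin. -/
theorem IsIntegralSolution.laplacian_sub_ge {N : ℕ} {β₁ β₂ : ℝ} {u₁ u₂ : ℝ → ℝ}
    (h₁ : IsIntegralSolution N β₁ u₁) (h₂ : IsIntegralSolution N β₂ u₂) (hβ : β₁ < β₂) {r : ℝ}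
    (hr : 0 ≤ r) : β₂ - β₁ ≤ integralLaplacian N β₂ u₂ r - integralLaplacian N β₁ u₁ r :=
  integralLaplacian_sub_ge h₁.continuous h₂.continuous hr fun s _ => h₁.le_of_lt h₂ hβ s

/-! ### Limits of the integral equation and monotone iteration. -/

/-- Derivatives of the potentials are locally bounded uniformly in `n`, so the pointwise limit
inherits a local Lipschitz bound. -/
theorem continuous_of_tendsto_radialPotential {N : ℕ} {f : ℕ → ℝ → ℝ} {u : ℝ → ℝ}
    (hf : ∀ n, Continuous (f n)) (hb : ∀ R : ℝ, ∃ C, ∀ n s, |s| ≤ R → |f n s| ≤ C)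
    (hu : ∀ r, Tendsto (fun n => radialPotential N (f n) r) atTop (𝓝 (u r))) :
    Continuous u := by
  rw [continuous_iff_continuousAt]
  intro x
  obtain ⟨C, hC⟩ := hb (|x| + 1)
  have hC0 : 0 ≤ C := (abs_nonneg _).trans (hC 0 x (by linarith))
  have hball : ∀ y, |y - x| < 1 → |y| ≤ |x| + 1 := fun y hy => by
    linarith [abs_sub_abs_le_abs_sub y x]
  refine continuousAt_of_locally_lipschitz one_pos ((|x| + 1) * C) fun y hy => ?_
  rw [Real.dist_eq, Real.dist_eq] at *
  refine le_of_tendsto ((hu y).sub (hu x)).abs (Eventually.of_forall fun n => ?_)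
  refine (convex_ball x 1).norm_image_sub_le_of_norm_hasDerivWithin_le
    (f' := fun s => s * radialMean (N - 1) (f n) s)
    (fun s _ => (hasDerivAt_radialPotential (hf n) s).hasDerivWithinAt) (fun s hs => ?_)
    (Metric.mem_ball_self one_pos) (by rwa [Metric.mem_ball, Real.dist_eq])
  rw [Metric.mem_ball, Real.dist_eq] at hs
  rw [Real.norm_eq_abs, abs_mul]
  exact mul_le_mul (hball s hs) (abs_radialMean_le (hf n) (hC n) (hball s hs)) (abs_nonneg _)
    (by positivity)

/-- Locally bounded pointwise limits in the integral equation are solutions. -/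
theorem isIntegralSolution_of_tendsto {N : ℕ} {b : ℕ → ℝ} {β : ℝ} {w : ℕ → ℝ → ℝ} {u : ℝ → ℝ}
    (hw : ∀ n, Continuous (w n)) (hweven : ∀ n r, w n (-r) = w n r)
    (hbdd : ∀ R : ℝ, ∃ C, ∀ n s, |s| ≤ R → |w n s| ≤ C) (hb : Tendsto b atTop (𝓝 β))
    (hwu : ∀ r, Tendsto (fun n => w n r) atTop (𝓝 (u r)))
    (hu : ∀ r, Tendsto (fun n => radialPotential N (integralLaplacian N (b n) (w n)) r) atTop
      (𝓝 (u r))) : IsIntegralSolution N β u := by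
  have he : ∀ n, Continuous fun s => Real.exp (w n s) := fun n => Real.continuous_exp.comp (hw n)
  have hv : ∀ n, Continuous (integralLaplacian N (b n) (w n)) := fun n =>
    continuous_integralLaplacian (hw n)
  have hebdd : ∀ R : ℝ, ∃ C, ∀ n s, |s| ≤ R → |Real.exp (w n s)| ≤ C := fun R => by
    obtain ⟨C, hC⟩ := hbdd R
    refine ⟨Real.exp C, fun n s hs => ?_⟩
    rw [Real.abs_exp]
    exact Real.exp_le_exp.2 (abs_le.1 (hC n s hs)).2
  have hvbdd : ∀ R : ℝ, ∃ C, ∀ n s, |s| ≤ R → |integralLaplacian N (b n) (w n) s| ≤ C :=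
    fun R => by
      obtain ⟨C, hC⟩ := hebdd R
      obtain ⟨B, hB⟩ := hb.abs.bddAbove_range
      refine ⟨B + R ^ 2 * C, fun n s hs => (abs_add_le _ _).trans (add_le_add (hB ⟨n, rfl⟩) ?_)⟩
      exact abs_radialPotential_le (he n) (hC n) hs
  have hvlim : ∀ r, Tendsto (fun n => integralLaplacian N (b n) (w n) r) atTop
      (𝓝 (integralLaplacian N β u r)) := fun r => by
    obtain ⟨C, hC⟩ := hebdd |r|
    exact hb.add (tendsto_radialPotential he hC
      (fun s _ => (Real.continuous_exp.tendsto _).comp (hwu s)) le_rfl)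
  refine ⟨fun r => ?_, continuous_of_tendsto_radialPotential hv hvbdd hu, fun r => ?_⟩
  · refine tendsto_nhds_unique (hwu (-r)) ?_
    simpa only [hweven] using hwu r
  · obtain ⟨C, hC⟩ := hvbdd |r|
    exact tendsto_nhds_unique (hu r) (tendsto_radialPotential hv hC (fun s _ => hvlim s) le_rfl)

theorem integralLaplacian_mono {N : ℕ} {β : ℝ} {u w : ℝ → ℝ} (hu : Continuous u)
    (hw : Continuous w) (h : ∀ r, u r ≤ w r) (r : ℝ) :
    integralLaplacian N β u r ≤ integralLaplacian N β w r :=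
  add_le_add le_rfl (radialPotential_mono (Real.continuous_exp.comp hu)
    (Real.continuous_exp.comp hw) fun _ _ => Real.exp_le_exp.2 (h _))

/-- A supersolution yields an entire solution. -/
theorem exists_isIntegralSolution_of_supersolution {N : ℕ} (hN : 1 ≤ N) {β : ℝ} {U : ℝ → ℝ}
    (hUc : Continuous U) (hUe : ∀ r, U (-r) = U r)
    (hU : ∀ r, 0 ≤ r → radialPotential N (integralLaplacian N β U) r ≤ U r) :
    ∃ u, IsIntegralSolution N β u := by
  have hU' : ∀ r, radialPotential N (integralLaplacian N β U) r ≤ U r := fun r => by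
    rcases le_total 0 r with hr | hr
    · exact hU r hr
    · rw [← hUe, ← radialPotential_even (integralLaplacian_even hUe)]
      exact hU _ (by linarith)
  set Φ : (ℝ → ℝ) → ℝ → ℝ := fun u => radialPotential N (integralLaplacian N β u) with hΦ
  set w : ℕ → ℝ → ℝ := fun n => Φ^[n] U with hw
  have hsucc : ∀ n, w (n + 1) = Φ (w n) := fun n => Function.iterate_succ_apply' Φ n U
  have hΦc : ∀ u, Continuous u → Continuous (Φ u) := fun u hu =>
    continuous_radialPotential (continuous_integralLaplacian hu)
  have hwc : ∀ n, Continuous (w n) := fun n => by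
    induction n with
    | zero => exact hUc
    | succ n ih => rw [hsucc]; exact hΦc _ ih
  have hwe : ∀ n r, w n (-r) = w n r := fun n => by
    induction n with
    | zero => exact hUe
    | succ n ih => rw [hsucc]; exact radialPotential_even (integralLaplacian_even ih)
  have hdec : ∀ n r, w (n + 1) r ≤ w n r := fun n => by
    induction n with
    | zero => exact hU'
    | succ n ih =>
      intro r
      rw [hsucc (n + 1), hsucc n]
      exact radialPotential_mono (continuous_integralLaplacian (hΦc _ (hwc n)))
        (continuous_integralLaplacian (hwc n)) fun t _ =>
          integralLaplacian_mono (hΦc _ (hwc n)) (hwc n) (fun r => by rw [← hsucc]; exact ih r) _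
  have hanti : ∀ r, Antitone fun n => w n r := fun r => antitone_nat_of_succ_le fun n => hdec n r
  -- Dropping the positive source `exp (w n)` leaves the potential of the constant `β`, a barrier
  -- from below.
  have hlow : ∀ n r, β * r ^ 2 / (2 * N) ≤ w n r := fun n r => by
    refine le_trans ?_ (hdec n r)
    rw [hsucc, ← radialPotential_const hN]
    refine radialPotential_mono continuous_const (continuous_integralLaplacian (hwc n)) fun t _ => ?_
    exact le_add_of_nonneg_right (radialPotential_nonneg (Real.continuous_exp.comp (hwc n))
      fun _ _ => (Real.exp_pos _).le)
  have hbelow : ∀ r, BddBelow (Set.range fun n => w n r) := fun r =>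
    ⟨β * r ^ 2 / (2 * N), by rintro _ ⟨n, rfl⟩; exact hlow n r⟩
  have hlim : ∀ r, Tendsto (fun n => w n r) atTop (𝓝 (⨅ n, w n r)) := fun r =>
    tendsto_atTop_ciInf (hanti r) (hbelow r)
  refine ⟨fun r => ⨅ n, w n r, isIntegralSolution_of_tendsto hwc hwe (fun R => ?_)
    (tendsto_const_nhds (x := β)) hlim fun r => ?_⟩
  · obtain ⟨C, hC⟩ := (isCompact_Icc (a := -R) (b := R)).exists_bound_of_continuousOn
      (f := fun r : ℝ => |β * r ^ 2 / (2 * N)| + |U r|) (by fun_prop)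
    refine ⟨C, fun n s hs => ?_⟩
    have h1 := (le_abs_self _).trans (hC s (abs_le.1 hs))
    have h2 : w n s ≤ U s := hanti s (Nat.zero_le n)
    have h3 := hlow n s
    rw [abs_le]
    constructor
    · linarith [neg_abs_le (β * s ^ 2 / (2 * N)), abs_nonneg (U s)]
    · linarith [le_abs_self (U s), abs_nonneg (β * s ^ 2 / (2 * N))]
  · have := (tendsto_add_atTop_iff_nat 1).2 (hlim r)
    simpa only [hsucc] using this

/-- A solution for a larger parameter is a supersolution for a smaller one. -/
theorem IsIntegralSolution.exists_of_le {N : ℕ} (hN : 1 ≤ N) {β β' : ℝ} {u : ℝ → ℝ}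
    (h : IsIntegralSolution N β u) (hβ : β' ≤ β) : ∃ u', IsIntegralSolution N β' u' := by
  refine exists_isIntegralSolution_of_supersolution hN h.continuous h.even fun r _ => ?_
  conv_rhs => rw [h.eq]
  exact radialPotential_mono (continuous_integralLaplacian h.continuous)
    (continuous_integralLaplacian h.continuous) fun t _ => add_le_add hβ le_rfl

/-! ### Bounded potentials, existence and openness. -/

/-- In dimension at least three, sources decaying like `r ^ (-4)` have bounded potentials. -/
theorem radialPotential_le_of_decay {N : ℕ} (hN : 3 ≤ N) {f : ℝ → ℝ} (hf : Continuous f) {D : ℝ}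
    (hD : 0 ≤ D) (hfD : ∀ t, 0 ≤ t → f t ≤ 2 * D / (1 + t) ^ 4) {r : ℝ} (hr : 0 ≤ r) :
    radialPotential N f r ≤ D := by
  obtain ⟨m, rfl⟩ : ∃ m, N = m + 3 := ⟨N - 3, by omega⟩
  have h1 : ∀ s, 0 ≤ s → s ^ (m + 2 + 1) * radialMean (m + 2) f s ≤
      D * (s ^ (m + 2) / (1 + s) ^ 2) := fun s hs => by
    refine le_of_hasDerivAt_le (fun s _ => hasDerivAt_pow_mul_radialMean (m + 2) hf s)
      (g := fun s => D * (s ^ (m + 2) / (1 + s) ^ 2))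
      (g' := fun s => D * (s ^ (m + 1) * (m + 2 + m * s) / (1 + s) ^ 3))
      (fun s hs => ?_) (fun s hs => ?_) (by simp) hs
    · have hs' : 1 + s ≠ 0 := by positivity
      refine (((hasDerivAt_pow (m + 2) s).div (((hasDerivAt_id s).const_add 1).pow 2)
        (pow_ne_zero 2 hs')).const_mul D).congr_deriv ?_
      simp only [id, Pi.pow_apply, show m + 2 - 1 = m + 1 by omega]
      field_simp
      push_cast
      ring
    · have hs' : 0 < 1 + s := by positivity
      have h2 : s ^ (m + 2) * f s ≤ s ^ (m + 2) * (2 * D / (1 + s) ^ 4) :=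
        mul_le_mul_of_nonneg_left (hfD s hs) (pow_nonneg hs _)
      refine h2.trans ?_
      rw [← mul_div_assoc, ← mul_div_assoc, div_le_div_iff₀ (by positivity) (by positivity)]
      -- The dimension enters here: with `m = N - 3 ≥ 0` the comparison function `s^(m+2)/(1+s)²`
      -- grows fast enough.
      have h3 : 2 * s ≤ (m + 2 + m * s) * (1 + s) := by
        nlinarith [mul_nonneg (Nat.cast_nonneg (α := ℝ) m) hs,
          mul_nonneg (Nat.cast_nonneg (α := ℝ) m) (mul_nonneg hs hs)]
      calc s ^ (m + 2) * (2 * D) * (1 + s) ^ 3 = (D * s ^ (m + 1) * (1 + s) ^ 3) * (2 * s) := by ring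
        _ ≤ (D * s ^ (m + 1) * (1 + s) ^ 3) *
            ((m + 2 + m * s) * (1 + s)) := by gcongr
        _ = _ := by ring
  have h2 : ∀ s, 0 ≤ s → s * radialMean (m + 2) f s ≤ D / (1 + s) ^ 2 := fun s hs => by
    rcases hs.eq_or_lt with rfl | hs0
    · simpa using hD
    refine le_of_mul_le_mul_left ?_ (pow_pos hs0 (m + 2))
    calc _ = s ^ (m + 2 + 1) * radialMean (m + 2) f s := by ring
      _ ≤ _ := h1 s hs
      _ = _ := by ring
  have h3 := le_of_hasDerivAt_le (fun s _ => hasDerivAt_radialPotential (N := m + 3) hf s)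
    (g := fun s => D - D * (1 + s)⁻¹) (g' := fun s => D / (1 + s) ^ 2) (fun s hs => by
      have hs' : 1 + s ≠ 0 := by positivity
      refine (((((hasDerivAt_id s).const_add 1).inv hs').const_mul D).const_sub D).congr_deriv ?_
      simp only [id]
      ring) h2 (by simp [radialPotential_zero]) hr
  have : 0 ≤ D * (1 + r)⁻¹ := by positivity
  linarith

/-- The bound `exp x ≥ x³/6` at `x = a (1 + t²)` gives the quartic decay. The weight `1 + r²` is
there to absorb the quadratic growth of the perturbation in `exists_gt`. -/
theorem exists_radialPotential_gaussian_le {N : ℕ} (hN : 3 ≤ N) {a : ℝ} (ha : 0 < a) :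
    ∃ K, ∀ r, 0 ≤ r →
      radialPotential N (fun r => (1 + r ^ 2) * Real.exp (-(a * r ^ 2))) r ≤ K := by
  refine ⟨12 * Real.exp a / a ^ 3, fun r hr => radialPotential_le_of_decay hN (by fun_prop)
    (by positivity) (fun t ht => ?_) hr⟩
  have h1 := Real.pow_div_factorial_le_exp (a * (1 + t ^ 2)) (by positivity) 3
  rw [mul_add, Real.exp_add, mul_one] at h1
  norm_num [Nat.factorial] at h1
  have h2 : (1 + t) ^ 4 ≤ 4 * (1 + t ^ 2) ^ 2 := by
    have : (1 + t) ^ 2 ≤ 2 * (1 + t ^ 2) := by nlinarith [sq_nonneg (1 - t)]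
    calc (1 + t) ^ 4 = ((1 + t) ^ 2) ^ 2 := by ring
      _ ≤ (2 * (1 + t ^ 2)) ^ 2 := by gcongr
      _ = _ := by ring
  have h3 : Real.exp (-(a * t ^ 2)) * Real.exp (a * t ^ 2) = 1 := by
    rw [← Real.exp_add, neg_add_cancel, Real.exp_zero]
  rw [le_div_iff₀ (by positivity)]
  calc (1 + t ^ 2) * Real.exp (-(a * t ^ 2)) * (1 + t) ^ 4
      ≤ (1 + t ^ 2) * Real.exp (-(a * t ^ 2)) * (4 * (1 + t ^ 2) ^ 2) := by gcongr
    _ = 24 / a ^ 3 * Real.exp (-(a * t ^ 2)) * ((a + a * t ^ 2) ^ 3 / 6) := by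
      field_simp
      ring
    _ ≤ 24 / a ^ 3 * Real.exp (-(a * t ^ 2)) * (Real.exp a * Real.exp (a * t ^ 2)) := by gcongr
    _ = 24 / a ^ 3 * Real.exp a * (Real.exp (-(a * t ^ 2)) * Real.exp (a * t ^ 2)) := by ring
    _ = _ := by
      rw [h3]
      ring

theorem exists_isIntegralSolution {N : ℕ} (hN : 3 ≤ N) : ∃ β u, IsIntegralSolution N β u := by
  have hN0 : (0 : ℝ) < N := by positivity
  obtain ⟨K, hK⟩ := exists_radialPotential_gaussian_le hN (a := 1 / (2 * N)) (by positivity)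
  have hUc : Continuous fun r : ℝ => -1 * r ^ 2 / (2 * (N : ℝ)) := by fun_prop
  -- The barrier has Laplacian `-1`, while its exponential source contributes at most `K`.
  refine ⟨-1 - K, exists_isIntegralSolution_of_supersolution (by omega)
    (U := fun r => -1 * r ^ 2 / (2 * N)) hUc (fun r => by simp) fun r hr => ?_⟩
  rw [← radialPotential_const (by omega : 1 ≤ N)]
  refine radialPotential_mono (continuous_integralLaplacian hUc) continuous_const fun t ht => ?_
  have h1 : radialPotential N (fun s => Real.exp (-1 * s ^ 2 / (2 * N))) (r * t) ≤ K := by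
    refine (radialPotential_mono (Real.continuous_exp.comp hUc) (by fun_prop) fun s _ => ?_).trans
      (hK _ (mul_nonneg hr ht.1))
    rw [Function.comp_apply, show -1 * (r * t * s) ^ 2 / (2 * (N : ℝ)) =
      -(1 / (2 * N) * (r * t * s) ^ 2) by ring]
    exact le_mul_of_one_le_left (Real.exp_pos _).le (by nlinarith [sq_nonneg (r * t * s)])
  rw [integralLaplacian]
  linarith

theorem radialPotential_le_of_le_const {N : ℕ} (hN : 1 ≤ N) {f : ℝ → ℝ} (hf : Continuous f)
    {r c : ℝ} (hr : 0 ≤ r) (h : ∀ s ∈ Set.Icc 0 r, f s ≤ c) :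
    radialPotential N f r ≤ c * r ^ 2 / (2 * N) := by
  rw [← radialPotential_const hN]
  exact radialPotential_mono hf continuous_const fun t ht =>
    h _ ⟨mul_nonneg hr ht.1, mul_le_of_le_one_right hr ht.2⟩

/-- The set of admissible parameters is open at a parameter whose Laplacian stays away from `0`. -/
theorem IsIntegralSolution.exists_gt {N : ℕ} (hN : 3 ≤ N) {β σ : ℝ} {u : ℝ → ℝ}
    (h : IsIntegralSolution N β u) (hσ : σ < 0)
    (hv : ∀ r, 0 ≤ r → integralLaplacian N β u r ≤ σ) :
    ∃ β' > β, ∃ u', IsIntegralSolution N β' u' := by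
  have hN1 : 1 ≤ N := by omega
  have hN0 : (3 : ℝ) ≤ N := by exact_mod_cast hN
  have hvc := continuous_integralLaplacian (N := N) (β := β) h.continuous
  -- Half of the decay rate `-σ/(2N)` of `u`; the other half is left for `W`.
  set a := -σ / (4 * N) with ha
  have ha0 : 0 < a := div_pos (by linarith) (by linarith)
  set k : ℝ → ℝ := fun r => (1 + r ^ 2) * Real.exp (-(a * r ^ 2)) with hk
  have hkc : Continuous k := by fun_prop
  have hk0 : ∀ r, 0 ≤ k r := fun r => by positivity
  obtain ⟨K, hK⟩ := exists_radialPotential_gaussian_le hN ha0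
  set E := radialPotential N k with hE
  have hEc : Continuous E := continuous_radialPotential hkc
  -- The factor `exp (-K)` offsets `E ≤ K`, so `Z = ε exp E` stays below `-σ/2`.
  set ε := -σ / 2 * Real.exp (-K) with hε
  have hε0 : 0 < ε := mul_pos (by linarith) (Real.exp_pos _)
  set Z : ℝ → ℝ := fun r => ε * Real.exp (E r) with hZ
  have hZc : Continuous Z := by fun_prop
  have hZ0 : ∀ r, 0 ≤ Z r := fun r => by positivity
  have hEmono : ∀ r s, 0 ≤ r → r ≤ s → E r ≤ E s := fun r s hr hrs => by
    simpa using radialPotential_ge hN1 hkc hr le_rfl (fun s _ => hk0 s)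
      (radialMean_nonneg hkc fun t _ => hk0 _) hrs
  have hZmono : ∀ r s, 0 ≤ r → r ≤ s → Z r ≤ Z s := fun r s hr hrs =>
    mul_le_mul_of_nonneg_left (Real.exp_le_exp.2 (hEmono r s hr hrs)) hε0.le
  have hZle : ∀ r, 0 ≤ r → Z r ≤ -σ / 2 := fun r hr => by
    have h1 : Real.exp (-K) * Real.exp (E r) ≤ 1 := by
      rw [← Real.exp_add, Real.exp_le_one_iff]
      linarith [hK r hr]
    calc Z r = -σ / 2 * (Real.exp (-K) * Real.exp (E r)) := by rw [hZ, hε]; ring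
      _ ≤ -σ / 2 * 1 := by gcongr; linarith
      _ = _ := mul_one _
  set W := radialPotential N Z with hW
  have hWc : Continuous W := continuous_radialPotential hZc
  have hZe : ∀ r, Z (-r) = Z r := fun r => by
    simp only [hZ]
    rw [hE, radialPotential_even fun r => by simp [hk]]
  -- Gronwall in integral form: `Z' = E' Z`, and `Z` is nondecreasing, so it may be moved out of the
  -- mean from above.
  have hZk : ∀ r, 0 ≤ r → radialPotential N (fun s => Z s * k s) r ≤ Z r - ε := fun r hr => by
    refine le_of_hasDerivAt_le
      (fun s _ => hasDerivAt_radialPotential (N := N) (hZc.mul hkc) s)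
      (g := fun s => Z s - ε) (g' := fun s => s * (radialMean (N - 1) k s * Z s)) (fun s _ => ?_)
      (fun s hs => ?_) (by simp [radialPotential_zero, hZ, hE]) hr
    · refine (((hasDerivAt_radialPotential (N := N) hkc s).exp.const_mul ε).sub_const
        ε).congr_deriv ?_
      simp only [hZ, hE]
      ring
    · refine mul_le_mul_of_nonneg_left ?_ hs
      rw [← radialMean_mul_const]
      refine radialMean_mono (hZc.mul hkc) (by fun_prop) fun t ht => ?_
      rw [mul_comm (k _)]
      exact mul_le_mul_of_nonneg_right
        (hZmono _ _ (mul_nonneg hs ht.1) (mul_le_of_le_one_right hs ht.2)) (hk0 _)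
  -- Convexity gives `exp (u + W) - exp u ≤ W exp (u + W)`; then `W ≤ Z (1 + s²)` and the Gaussian
  -- bound apply. Together with `hZk` this makes `u + W` a supersolution for `β + ε`.
  have hexp : ∀ s, 0 ≤ s → Real.exp (u s + W s) ≤ Real.exp (u s) + Z s * k s := fun s hs => by
    have hu : u s ≤ σ * s ^ 2 / (2 * N) := by
      rw [h.eq]
      exact radialPotential_le_of_le_const hN1 hvc hs fun t ht => hv t ht.1
    have hW1 : W s ≤ -σ / 2 * s ^ 2 / (2 * N) :=
      radialPotential_le_of_le_const hN1 hZc hs fun t ht => hZle t ht.1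
    have hW2 : W s ≤ Z s * s ^ 2 / (2 * N) :=
      radialPotential_le_of_le_const hN1 hZc hs fun t ht => hZmono t s ht.1 ht.2
    have hW3 : W s ≤ Z s * (1 + s ^ 2) := by
      refine hW2.trans ?_
      rw [mul_div_assoc]
      refine mul_le_mul_of_nonneg_left ?_ (hZ0 s)
      rw [div_le_iff₀ (by positivity)]
      nlinarith [sq_nonneg s]
    have h1 : Real.exp (u s + W s) ≤ Real.exp (-(a * s ^ 2)) := by
      refine Real.exp_le_exp.2 ((add_le_add hu hW1).trans (le_of_eq ?_))
      rw [ha]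
      field_simp
      ring
    have h2 : Real.exp (u s + W s) * (1 - W s) ≤ Real.exp (u s) := by
      calc _ ≤ Real.exp (u s + W s) * Real.exp (-W s) := by
            gcongr
            linarith [Real.add_one_le_exp (-W s)]
        _ = _ := by rw [← Real.exp_add, add_neg_cancel_right]
    have h3 : Real.exp (u s + W s) * W s ≤ Z s * k s := by
      calc _ ≤ Real.exp (u s + W s) * (Z s * (1 + s ^ 2)) := by gcongr
        _ ≤ Real.exp (-(a * s ^ 2)) * (Z s * (1 + s ^ 2)) := by
          have := hZ0 s
          gcongr
        _ = _ := by rw [hk]; ring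
    linarith
  have hUc : Continuous fun r => u r + W r := h.continuous.add hWc
  refine ⟨β + ε, by linarith, exists_isIntegralSolution_of_supersolution hN1
    (U := fun r => u r + W r) hUc (fun r => ?_) fun r hr => ?_⟩
  · rw [h.even, hW, radialPotential_even hZe]
  · rw [h.eq r, hW, ← radialPotential_add hvc hZc]
    refine radialPotential_mono (continuous_integralLaplacian hUc) (hvc.add hZc) fun t ht => ?_
    have hs : 0 ≤ r * t := mul_nonneg hr ht.1
    have he : Continuous fun s => Real.exp (u s) := Real.continuous_exp.comp h.continuous
    have hZkc : Continuous fun s => Z s * k s := hZc.mul hkc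
    have hsum : Continuous fun s => Real.exp (u s) + Z s * k s := he.add hZkc
    have h1 := radialPotential_mono (N := N) (r := r * t) (Real.continuous_exp.comp hUc)
      hsum fun x hx => hexp (r * t * x) (mul_nonneg hs hx.1)
    have h2 := radialPotential_add (N := N) he hZkc (r * t)
    have h3 := hZk _ hs
    simp only [integralLaplacian, Pi.add_apply]
    simp only [Function.comp_def] at h1
    linarith

/-! ### The threshold is attained; conclusion. -/

/-- Solutions for parameters increasing to `β` increase pointwise and are bounded above by `0`, so
their limit is a solution. -/
theorem exists_isIntegralSolution_of_isLUB {N : ℕ} (hN : 1 ≤ N) {β : ℝ}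
    (hβ : IsLUB {β | ∃ u, IsIntegralSolution N β u} β) : ∃ u, IsIntegralSolution N β u := by
  obtain ⟨b, hbmono, hblt, hb⟩ := exists_seq_strictMono_tendsto β
  have hex : ∀ n, ∃ u, IsIntegralSolution N (b n) u := fun n => by
    obtain ⟨β', ⟨u, hu⟩, hlt, -⟩ := hβ.exists_between (hblt n)
    exact hu.exists_of_le hN hlt.le
  choose w hw using hex
  have hmono : ∀ r, Monotone fun n => w n r := fun r =>
    monotone_nat_of_le_succ fun n => (hw n).le_of_lt (hw (n + 1)) (hbmono n.lt_succ_self) r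
  have hlim : ∀ r, Tendsto (fun n => w n r) atTop (𝓝 (⨆ n, w n r)) := fun r =>
    tendsto_atTop_ciSup (hmono r) ⟨0, by rintro _ ⟨n, rfl⟩; exact (hw n).nonpos hN r⟩
  refine ⟨fun r => ⨆ n, w n r, isIntegralSolution_of_tendsto (fun n => (hw n).continuous)
    (fun n => (hw n).even) (fun R => ?_) hb hlim fun r => ?_⟩
  · obtain ⟨C, hC⟩ := (isCompact_Icc (a := -R) (b := R)).exists_bound_of_continuousOn
      (hw 0).continuous.continuousOn
    refine ⟨C, fun n s hs => le_trans ?_ (hC s (abs_le.1 hs))⟩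
    rw [Real.norm_eq_abs, abs_of_nonpos ((hw n).nonpos hN s), abs_of_nonpos ((hw 0).nonpos hN s)]
    exact neg_le_neg (hmono s (Nat.zero_le n))
  · simpa only [← (hw _).eq] using hlim r

theorem proposition3p1 (N : ℕ) (hN : 3 ≤ N) :
    (∀ β : ℝ, (∃ u : ℝ → ℝ, IsEntireRadialSolution N β u) ↔ β ≤ betaZero N) ∧
    ∀ β : ℝ, β ≤ betaZero N → ∀ u : ℝ → ℝ, IsEntireRadialSolution N β u →
      ∃ σ : ℝ, Tendsto (radialLaplacian N u) atTop (𝓝 σ) ∧ σ ≤ 0 ∧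
        (σ = 0 ↔ β = betaZero N) := by
  have hN1 : 1 ≤ N := by omega
  have hset : {β : ℝ | ∃ u : ℝ → ℝ, IsEntireRadialSolution N β u} =
      {β | ∃ u, IsIntegralSolution N β u} := Set.ext fun β =>
    ⟨fun ⟨u, hu⟩ => ⟨u, hu.isIntegralSolution hN⟩,
      fun ⟨u, hu⟩ => ⟨u, hu.isEntireRadialSolution hN1⟩⟩
  have hlub : IsLUB {β | ∃ u, IsIntegralSolution N β u} (betaZero N) := by
    rw [betaZero, hset]
    refine isLUB_csSup (exists_isIntegralSolution hN) ⟨0, fun β ⟨u, hu⟩ => ?_⟩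
    simpa [integralLaplacian, radialPotential_zero] using hu.laplacian_nonpos hN1 le_rfl
  obtain ⟨u₀, hu₀⟩ := exists_isIntegralSolution_of_isLUB hN1 hlub
  refine ⟨fun β => ⟨fun ⟨u, hu⟩ => hlub.1 ⟨u, hu.isIntegralSolution hN⟩, fun hβ => ?_⟩,
    fun β hβ u hu => ?_⟩
  · obtain ⟨u, hu⟩ := hu₀.exists_of_le hN1 hβ
    exact ⟨u, hu.isEntireRadialSolution hN1⟩
  have hi := hu.isIntegralSolution hN
  obtain ⟨σ, hσ, hlim, hle⟩ := hi.exists_tendsto_laplacian hN1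
  refine ⟨σ, hu.radialLaplacian_eq hN ▸ hlim, hσ, fun hσ0 => ?_, fun hβ0 => ?_⟩
  · by_contra hne
    have hlt := lt_of_le_of_ne hβ hne
    -- The gap to the solution `u₀` at the threshold, whose Laplacian is nonpositive, survives in
    -- the limit.
    have : betaZero N - β ≤ 0 - σ := by
      refine ge_of_tendsto (tendsto_const_nhds.sub hlim) ?_
      filter_upwards [eventually_ge_atTop 0] with r hr
      have h1 := hi.laplacian_sub_ge hu₀ hlt hr
      have h2 := hu₀.laplacian_nonpos hN1 hr
      linarith
    linarith
  · by_contra hne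
    obtain ⟨β', hβ', u', hu'⟩ := hi.exists_gt hN (lt_of_le_of_ne hσ hne) hle
    exact absurd (hlub.1 ⟨u', hu'⟩) (not_le.2 (hβ0 ▸ hβ'))
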